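/- There exists a universal constant $\alpha>0$ such that the following holds for every integer $d\ge 1$. Let $\mathcal X=\mathbb R^d$ and let $\mathcal H_d\subseteq\{0,1\}^{\mathcal X}$ be the class of (indicator functions of) closed half-spaces $\{x\in\mathbb R^d:\langle w,x\rangle\ge b\}$, with $w\in\mathbb R^d\setminus\{0\}$ and $b\in\mathbb R$. For a probability distribution $\mathcal D$ on $\mathcal X\times\{0,1\}$ and $h:\mathcal X\to\{0,1\}$ write $L_{\mathcal D}(h)=\Pr_{(x,y)\sim\mathcal D}[h(x)\ne y]$, and call $\mathcal D$ realizable for $\mathcal H_d$ if $\inf_{h\in\mathcal H_d}L_{\mathcal D}(h)=0$. A learning algorithm $\hat h$ is a (measurable, possibly randomized) map that takes a finite sample $S\in(\mathcal X\times\{0,1\})^n$, for any $n$, to a function $\hat h_S:\mathcal X\to\{0,1\}$. Then for every learning algorithm $\hat h$ there exists a distribution $\mathcal D$, realizable for $\mathcal H_d$, such that the inequality $$\mathbb E_{S\sim\mathcal D^n}\big[L_{\mathcal D}(\hat h_S)\big]\ \ge\ \alpha\cdot\frac dn$$ holds for infinitely many $n\in\mathbb N$, where the expectation is over the i.i.d.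 sample $S$ and the internal randomness of $\hat h$. -/

import Mathlib

open MeasureTheory
open scoped ENNReal RealInnerProductSpace

namespace LearningCurves

/-- A (possibly randomized) learning algorithm for functions `X → {0,1}`. The random seed `ω` is
drawn from the probability space `(Ω, seed)`, independently of the sample; `predict n ω S` is the
function `X → {0,1}` that is output on the sample `S ∈ (X × {0,1})ⁿ` with seed `ω`.

The measurability condition is the weakest usual one. When `Ω` is a one-point space (a deterministic
algorithm) it says that `(S, x) ↦ predict n ω S x` is universally measurable for every `n`.
Jointly Borel measurable algorithms also satisfy it. -/
structure LearningAlgorithm (Ω X : Type*) [MeasurableSpace Ω] [MeasurableSpace X] where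
  seed : Measure Ω
  isProbabilityMeasure_seed : IsProbabilityMeasure seed
  predict : (n : ℕ) → Ω → (Fin n → X × Bool) → X → Bool
  nullMeasurable_predict : ∀ (n : ℕ) (ν : Measure ((Fin n → X × Bool) × X)),
    IsProbabilityMeasure ν →
      NullMeasurable
        (fun p : Ω × ((Fin n → X × Bool) × X) => predict n p.1 p.2.1 p.2.2) (seed.prod ν)

/-- The 0-1 loss `P_{(x,y) ∼ D}[h(x) ≠ y]`. -/
def loss {X : Type*} [MeasurableSpace X] (D : Measure (X × Bool)) (h : X → Bool) : ℝ≥0∞ :=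
  D {z | h z.1 ≠ z.2}

/-- The set of realizable distributions for the hypothesis class `H`. -/
def Realizable {X : Type*} [MeasurableSpace X] (H : Set (X → Bool)) : Set (Measure (X × Bool)) :=
  {D | IsProbabilityMeasure D ∧ ⨅ h ∈ H, loss D h = 0}

/-- The expected 0-1 loss with respect to `D` of the output of the algorithm `A` on a sample of `n`
i.i.d. points from `D`; the expectation is over the sample and the seed of `A`. -/
noncomputable def expectedLoss {Ω X : Type*} [MeasurableSpace Ω] [MeasurableSpace X]
    (A : LearningAlgorithm Ω X) (D : Measure (X × Bool)) (n : ℕ) : ℝ≥0∞ :=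
  ∫⁻ p : Ω × (Fin n → X × Bool), loss D (A.predict n p.1 p.2)
    ∂(A.seed.prod (Measure.pi fun _ : Fin n => D))

/-- The class of (indicator functions of) closed half-spaces `{x | b ≤ ⟨w, x⟩}`, `w ≠ 0`, in
`ℝ^d`. -/
def closedHalfSpaces (d : ℕ) : Set (EuclideanSpace ℝ (Fin d) → Bool) :=
  {h | ∃ w : EuclideanSpace ℝ (Fin d), w ≠ 0 ∧ ∃ b : ℝ, ∀ x, h x = true ↔ b ≤ ⟪w, x⟫}

end LearningCurves

namespace LearningCurves

/-! ### The adversary on a product of `d` trees -/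

section Blocks

variable {Ω X : Type*} [MeasurableSpace Ω] [MeasurableSpace X] {d : ℕ}

/-! Each coordinate axis carries an infinite binary tree of points, and any choice of branches in
the `d` trees is realized by one half-space (`map_labeledPoint_mem_realizable`). The law `Q` of the
index is fixed: uniform over axes, geometric over levels with ratio `1 / (4 * d)`. Only the branch
is adversarial.

At sample size `N k`, of order `d` times the inverse mass of level `k`, a given index `(i, k)` and
all deeper levels are missed with probability at least `1 / 2`. Such a sample says nothing about the
bit of axis `i` at level `k`, so the algorithm errs there for one of its two values
(`subset_errorEvent_union`). Averaging over the `d` bits of the level gives a choice with at least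
`d / 4` expected errors at that level, each costing `Q {(i, k)}`.

Errors at level `k` do not involve later bits, so the levels can be fixed successively. A single
branch, hence a single distribution, then works for every `N k` with `k ≥ 1`. -/

/-- The example with index `t = (i, k)` of the tree of points `x` along the branch `a`. The branch
labels the point `x a i k` by `a k i`. -/
def labeledPoint (x : (ℕ → Fin d → Bool) → Fin d → ℕ → X) (a : ℕ → Fin d → Bool)
    (t : Fin d × ℕ) : X × Bool :=
  (x a t.1 t.2, a t.2 t.1)

/-- The indices up to level `k` other than `(i, k)`. -/
def indicesExcept (i : Fin d) (k : ℕ) : Set (Fin d × ℕ) :=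
  {t | t.2 ≤ k ∧ t ≠ (i, k)}

/-- The event that the sample avoids the point `(i, k)` and all levels above `k`, and the algorithm
errs at the point `(i, k)`. -/
def errorEvent (A : LearningAlgorithm Ω X) (x : (ℕ → Fin d → Bool) → Fin d → ℕ → X) (n : ℕ)
    (k : ℕ) (i : Fin d) (a : ℕ → Fin d → Bool) : Set (Ω × (Fin n → Fin d × ℕ)) :=
  {p | (∀ j, p.2 j ∈ indicesExcept i k) ∧
    A.predict n p.1 (fun j => labeledPoint x a (p.2 j)) (x a i k) ≠ a k i}

/-- The node `x a i k` depends only on the levels of the branch `a` below `k`. -/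
def IsPredictable (x : (ℕ → Fin d → Bool) → Fin d → ℕ → X) : Prop :=
  ∀ a a' i k, (∀ j < k, a j i = a' j i) → x a i k = x a' i k

variable {x : (ℕ → Fin d → Bool) → Fin d → ℕ → X}

theorem errorEvent_congr (hx : IsPredictable x) (A : LearningAlgorithm Ω X) (n k : ℕ) (i : Fin d)
    {a a' : ℕ → Fin d → Bool} (h : ∀ j ≤ k, a j = a' j) :
    errorEvent A x n k i a = errorEvent A x n k i a' := by
  ext p
  refine and_congr_right fun hp => ?_
  have h1 : (fun j => labeledPoint x a (p.2 j)) = fun j => labeledPoint x a' (p.2 j) := by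
    funext j
    have hj := (hp j).1
    refine Prod.ext (hx _ _ _ _ fun l hl => ?_) ?_
    · rw [h l (hl.le.trans hj)]
    · simp only [labeledPoint]
      rw [h _ hj]
  rw [h1, hx a a' i k fun l hl => by rw [h l hl.le], h k le_rfl]

/-- The bits at level `k` with the bit at `i` flipped. -/
def flipBit (i : Fin d) (b : Fin d → Bool) : Fin d → Bool :=
  Function.update b i (!b i)

theorem flipBit_involutive (i : Fin d) : Function.Involutive (flipBit i) := by
  intro b
  simp [flipBit]

/-- Flipping bit `i` of level `k` moves no point of level at most `k` and changes only the label of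
`(i, k)`. The algorithm thus sees the same sample and predicts the same value under both labels. -/
theorem subset_errorEvent_union (hx : IsPredictable x) (A : LearningAlgorithm Ω X) (n k : ℕ)
    (i : Fin d) (a : ℕ → Fin d → Bool) (b : Fin d → Bool) :
    (Set.univ : Set Ω) ×ˢ (Set.univ.pi fun _ : Fin n => indicesExcept i k) ⊆
      errorEvent A x n k i (Function.update a k b) ∪
        errorEvent A x n k i (Function.update a k (flipBit i b)) := by
  rintro ⟨ω, T⟩ ⟨-, hT⟩
  replace hT : ∀ j, T j ∈ indicesExcept i k := fun j => hT j trivial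
  have hlow : ∀ b' : Fin d → Bool, ∀ j < k, Function.update a k b' j = a j :=
    fun b' j hj => Function.update_of_ne hj.ne _ _
  have hnode : ∀ i' l, l ≤ k →
      x (Function.update a k (flipBit i b)) i' l = x (Function.update a k b) i' l := fun i' l hl =>
    hx _ _ _ _ fun j hj => by rw [hlow _ _ (hj.trans_le hl), hlow _ _ (hj.trans_le hl)]
  have hsample : (fun j => labeledPoint x (Function.update a k (flipBit i b)) (T j)) =
      fun j => labeledPoint x (Function.update a k b) (T j) := by
    funext j
    obtain ⟨h1, h2⟩ := hT j
    refine Prod.ext (hnode _ _ h1) ?_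
    simp only [labeledPoint]
    rcases h1.lt_or_eq with h | h
    · rw [hlow _ _ h, hlow _ _ h]
    · have hi : (T j).1 ≠ i := fun hi => h2 (Prod.ext hi h)
      simp [h, flipBit, hi]
  by_cases hp : A.predict n ω (fun j => labeledPoint x (Function.update a k b) (T j))
      (x (Function.update a k b) i k) = b i
  · right
    refine ⟨hT, ?_⟩
    simp only [hsample, hnode i k le_rfl, hp]
    simp [flipBit]
  · left
    exact ⟨hT, by simpa using hp⟩

/-- The bits at level `k` can be chosen so that the algorithm errs on many points of this level. -/
theorem exists_le_sum_errorEvent (hx : IsPredictable x) (A : LearningAlgorithm Ω X)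
    (Q : Measure (Fin d × ℕ)) [IsProbabilityMeasure Q] (n k : ℕ) (a : ℕ → Fin d → Bool) :
    ∃ b, ∑ i, Q (indicesExcept i k) ^ n ≤
      2 * ∑ i, (A.seed.prod (Measure.pi fun _ => Q))
        (errorEvent A x n k i (Function.update a k b)) := by
  have := A.isProbabilityMeasure_seed
  set μ := A.seed.prod (Measure.pi fun _ : Fin n => Q)
  have hpair : ∀ i b, Q (indicesExcept i k) ^ n ≤
      μ (errorEvent A x n k i (Function.update a k b)) +
        μ (errorEvent A x n k i (Function.update a k (flipBit i b))) := by
    intro i b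
    refine le_trans (le_of_eq ?_)
      ((measure_mono (subset_errorEvent_union hx A n k i a b)).trans (measure_union_le _ _))
    simp [μ, Measure.prod_prod, Measure.pi_pi]
  -- Average over all `b`: since `flipBit i` permutes the bit vectors, both terms of `hpair` have
  -- the same sum, whence the factor 2.
  by_contra! hlt
  have h1 := ENNReal.sum_lt_sum_of_nonempty (s := (Finset.univ : Finset (Fin d → Bool)))
    Finset.univ_nonempty fun b _ => hlt b
  refine absurd h1 (not_lt.2 ?_)
  rw [← Finset.mul_sum, Finset.sum_comm, Finset.sum_comm (s := Finset.univ (α := Fin d → Bool)),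
    Finset.mul_sum]
  refine Finset.sum_le_sum fun i _ => ?_
  have h2 : ∑ b, μ (errorEvent A x n k i (Function.update a k (flipBit i b))) =
      ∑ b, μ (errorEvent A x n k i (Function.update a k b)) :=
    Equiv.sum_comp (flipBit_involutive i).toPerm
      fun b => μ (errorEvent A x n k i (Function.update a k b))
  calc _ ≤ _ := Finset.sum_le_sum fun b _ => hpair i b
    _ = _ := by rw [Finset.sum_add_distrib, h2, two_mul]

/-- A sequence can be built by successively choosing its values, if the requirement at `k` depends
only on the values up to `k`. -/
theorem exists_seq_of_forall_exists_update {β : Type*} [Inhabited β] (P : ℕ → (ℕ → β) → Prop)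
    (hcongr : ∀ k a a', (∀ j ≤ k, a j = a' j) → P k a → P k a')
    (hex : ∀ k a, ∃ b, P k (Function.update a k b)) : ∃ a, ∀ k, P k a := by
  choose b hb using hex
  let s : ℕ → ℕ → β := fun m => Nat.rec (fun _ => default)
    (fun k u => Function.update u k (b k u)) m
  have hs : ∀ m, s (m + 1) = Function.update (s m) m (b m (s m)) := fun _ => rfl
  have hstab : ∀ j m, j < m → s m j = s (j + 1) j := by
    intro j m hjm
    induction m, hjm using Nat.le_induction with
    | base => rfl
    | succ m hm ih => rw [hs, Function.update_of_ne (by omega), ih]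
  refine ⟨fun k => s (k + 1) k, fun k => hcongr k (s (k + 1)) _ ?_ ?_⟩
  · exact fun j hj => hstab j (k + 1) (by omega)
  · rw [hs]
    exact hb k (s k)

theorem exists_forall_le_sum_errorEvent (hx : IsPredictable x) (A : LearningAlgorithm Ω X)
    (Q : Measure (Fin d × ℕ)) [IsProbabilityMeasure Q] (N : ℕ → ℕ) :
    ∃ a, ∀ k, ∑ i, Q (indicesExcept i k) ^ N k ≤
      2 * ∑ i, (A.seed.prod (Measure.pi fun _ => Q)) (errorEvent A x (N k) k i a) := by
  refine exists_seq_of_forall_exists_update _ (fun k a a' h hk => ?_)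
    fun k a => exists_le_sum_errorEvent hx A Q (N k) k a
  simpa only [errorEvent_congr hx A (N k) k _ h] using hk

/-- The test point is frozen by applying the measurability axiom to the law of `(S, z)` with `z`
constant. -/
theorem LearningAlgorithm.nullMeasurableSet_ne (A : LearningAlgorithm Ω X) (n : ℕ)
    (μ : Measure (Fin n → X × Bool)) [IsProbabilityMeasure μ] (z : X) (c : Bool) :
    NullMeasurableSet {p : Ω × (Fin n → X × Bool) | A.predict n p.1 p.2 z ≠ c}
      (A.seed.prod μ) := by
  have := A.isProbabilityMeasure_seed
  have hm : Measurable fun S : Fin n → X × Bool => (S, z) := by fun_prop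
  have hν : IsProbabilityMeasure (μ.map fun S => (S, z)) :=
    Measure.isProbabilityMeasure_map hm.aemeasurable
  have hmp : MeasurePreserving (Prod.map id fun S : Fin n → X × Bool => (S, z))
      (A.seed.prod μ) (A.seed.prod (μ.map fun S => (S, z))) :=
    (MeasurePreserving.id _).prod ⟨hm, rfl⟩
  exact NullMeasurableSet.preimage
    (A.nullMeasurable_predict n _ hν (MeasurableSet.of_discrete (s := {c}ᶜ)))
    hmp.quasiMeasurePreserving

/-- Errors are counted on indices, so the points need not be distinct. Only the inequality for outer
measures is used, as `h` may be non-measurable. -/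
theorem le_loss_map (Q : Measure (Fin d × ℕ)) (a : ℕ → Fin d → Bool) (h : X → Bool) (k : ℕ) :
    ∑ i, {i | h (x a i k) ≠ a k i}.indicator (fun i => Q {(i, k)}) i ≤
      loss (Q.map (labeledPoint x a)) h := by
  classical
  refine le_trans ?_ (Measure.le_map_apply Measurable.of_discrete.aemeasurable _)
  simp only [Set.indicator_apply]
  let e : Fin d ↪ Fin d × ℕ := ⟨fun i => (i, k), fun _ _ h => (Prod.ext_iff.1 h).1⟩
  rw [← Finset.sum_filter]
  refine le_trans (le_of_eq (Finset.sum_map _ e fun t => Q {t}).symm) ?_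
  rw [sum_measure_singleton]
  refine measure_mono fun t ht => ?_
  obtain ⟨i, hi, rfl⟩ := Finset.mem_map.1 (Finset.mem_coe.1 ht)
  exact (Finset.mem_filter.1 hi).2

/-- The points at level `k` on which the algorithm errs bound its expected loss from below. -/
theorem sum_errorEvent_le_expectedLoss (A : LearningAlgorithm Ω X)
    (Q : Measure (Fin d × ℕ)) [IsProbabilityMeasure Q] (n k : ℕ) (a : ℕ → Fin d → Bool) :
    ∑ i, Q {(i, k)} * (A.seed.prod (Measure.pi fun _ => Q)) (errorEvent A x n k i a) ≤
      expectedLoss A (Q.map (labeledPoint x a)) n := by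
  have := A.isProbabilityMeasure_seed
  have hmeas : Measurable (labeledPoint x a) := Measurable.of_discrete
  have hD : IsProbabilityMeasure (Q.map (labeledPoint x a)) :=
    Measure.isProbabilityMeasure_map hmeas.aemeasurable
  set D := Q.map (labeledPoint x a)
  have hnull := fun i => A.nullMeasurableSet_ne n (Measure.pi fun _ => D) (x a i k) (a k i)
  have hT : Measurable fun (T : Fin n → Fin d × ℕ) j => labeledPoint x a (T j) :=
    measurable_pi_lambda _ fun j => hmeas.comp (measurable_pi_apply j)
  have hmap : A.seed.prod (Measure.pi fun _ : Fin n => D) =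
      (A.seed.prod (Measure.pi fun _ : Fin n => Q)).map
        (Prod.map id fun T j => labeledPoint x a (T j)) := by
    rw [← Measure.map_prod_map _ _ measurable_id hT, Measure.map_id,
      Measure.pi_map_pi fun _ => hmeas.aemeasurable]
  calc ∑ i, Q {(i, k)} * (A.seed.prod (Measure.pi fun _ => Q)) (errorEvent A x n k i a)
      ≤ ∑ i, Q {(i, k)} * (A.seed.prod (Measure.pi fun _ => D))
          {p | A.predict n p.1 p.2 (x a i k) ≠ a k i} := by
        gcongr with i
        rw [hmap]
        refine le_trans (measure_mono fun p hp => ?_)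
          (Measure.le_map_apply (measurable_id.prodMap hT).aemeasurable _)
        exact hp.2
    _ = ∫⁻ p : Ω × (Fin n → X × Bool),
          ∑ i, {p : Ω × (Fin n → X × Bool) | A.predict n p.1 p.2 (x a i k) ≠ a k i}.indicator
            (fun _ => Q {(i, k)}) p ∂(A.seed.prod (Measure.pi fun _ => D)) := by
        rw [lintegral_finsetSum' _ fun i _ => aemeasurable_const.indicator₀ (hnull i)]
        exact Finset.sum_congr rfl fun i _ => (lintegral_indicator_const₀ (hnull i) _).symm
    _ ≤ expectedLoss A D n :=
        lintegral_mono fun p => le_loss_map Q a (A.predict n p.1 p.2) k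

end Blocks

/-! ### Masses of the index distribution -/

section Weights

/-- The product of the uniform distribution on `Fin d` and the geometric distribution on `ℕ` with
success probability `p`. -/
noncomputable def indexMeasure (d : ℕ) [NeZero d] (p : unitInterval) : Measure (Fin d × ℕ) :=
  (PMF.uniformOfFintype (Fin d)).toMeasure.prod (ProbabilityTheory.geometricMeasure p)

variable {d : ℕ} [NeZero d] {p : unitInterval}

instance : IsProbabilityMeasure (indexMeasure d p) := by
  unfold indexMeasure
  infer_instance

theorem indexMeasure_real_singleton (hp : p ≠ 0) (i : Fin d) (k : ℕ) :
    (indexMeasure d p).real {(i, k)} = (1 - p) ^ k * p / d := by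
  rw [← Set.singleton_prod_singleton, indexMeasure, measureReal_prod_prod,
    ProbabilityTheory.geometricMeasure_real_singleton hp, measureReal_def,
    PMF.toMeasure_apply_singleton _ _ (MeasurableSet.singleton i)]
  simp
  ring

theorem geometricMeasure_real_Ioi (hp : p ≠ 0) (k : ℕ) :
    (ProbabilityTheory.geometricMeasure p).real (Set.Ioi k) = (1 - p : ℝ) ^ (k + 1) := by
  have h := sum_measureReal_singleton (μ := ProbabilityTheory.geometricMeasure p)
    (Finset.range (k + 1))
  simp only [ProbabilityTheory.geometricMeasure_real_singleton hp] at h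
  have hc : Set.Ioi k = ((Finset.range (k + 1) : Finset ℕ) : Set ℕ)ᶜ := by
    ext l
    simp
  have hg := mul_neg_geom_sum (1 - p : ℝ) (k + 1)
  rw [hc, measureReal_compl MeasurableSet.of_discrete, ← h, probReal_univ, ← Finset.sum_mul]
  linear_combination -hg

theorem le_indexMeasure_real_indicesExcept (hp : p ≠ 0) (i : Fin d) (k : ℕ) :
    1 - (1 - p : ℝ) ^ k * (p / d + (1 - p)) ≤ (indexMeasure d p).real (indicesExcept i k) := by
  have hsub : (indicesExcept i k)ᶜ ⊆ {(i, k)} ∪ Set.univ ×ˢ Set.Ioi k := by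
    intro t ht
    by_cases h : t.2 ≤ k
    · left
      by_contra h'
      exact ht ⟨h, h'⟩
    · right
      exact ⟨trivial, not_le.1 h⟩
  have h1 := (measureReal_mono (μ := indexMeasure d p) hsub).trans (measureReal_union_le _ _)
  rw [measureReal_compl MeasurableSet.of_discrete, probReal_univ,
    indexMeasure_real_singleton hp] at h1
  have h2 : (indexMeasure d p).real (Set.univ ×ˢ Set.Ioi k) = (1 - p : ℝ) ^ (k + 1) := by
    rw [indexMeasure, measureReal_prod_prod, geometricMeasure_real_Ioi hp, probReal_univ, one_mul]
  rw [h2] at h1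
  have h3 : (1 - p : ℝ) ^ k * (p / d + (1 - p)) = (1 - p) ^ k * p / d + (1 - p : ℝ) ^ (k + 1) := by
    ring
  linarith

end Weights

/-! ### Half-spaces realize every branch -/

section HalfSpaces

/-- The partial sums of the ternary expansion with digits `2 * c j`, shifted by one. -/
noncomputable def cantorSum (c : ℕ → Bool) (k : ℕ) : ℝ :=
  1 + ∑ j ∈ Finset.range k, if c j then 2 / 3 ^ (j + 1) else 0

theorem cantorSum_succ (c : ℕ → Bool) (k : ℕ) :
    cantorSum c (k + 1) = cantorSum c k + if c k then 2 / 3 ^ (k + 1) else 0 := by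
  rw [cantorSum, cantorSum, Finset.sum_range_succ, add_assoc]

theorem cantorSum_mono (c : ℕ → Bool) : Monotone (cantorSum c) := by
  refine monotone_nat_of_le_succ fun k => ?_
  rw [cantorSum_succ]
  split_ifs
  · have : (0 : ℝ) ≤ 2 / 3 ^ (k + 1) := by positivity
    linarith
  · simp

theorem one_le_cantorSum (c : ℕ → Bool) (k : ℕ) : 1 ≤ cantorSum c k := by
  simpa [cantorSum] using cantorSum_mono c (Nat.zero_le k)

theorem antitone_cantorSum_add (c : ℕ → Bool) :
    Antitone fun k => cantorSum c k + 1 / 3 ^ k := by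
  refine antitone_nat_of_succ_le fun k => ?_
  have h : (1 : ℝ) / 3 ^ k = 3 / 3 ^ (k + 1) := by
    rw [pow_succ]
    field_simp
  have h' : (0 : ℝ) < 1 / 3 ^ (k + 1) := by positivity
  rw [cantorSum_succ, h]
  split_ifs
  · exact le_of_eq (by ring)
  · have : (3 : ℝ) / 3 ^ (k + 1) = 3 * (1 / 3 ^ (k + 1)) := by ring
    linarith

theorem cantorSum_le_add (c : ℕ → Bool) (k m : ℕ) : cantorSum c m ≤ cantorSum c k + 1 / 3 ^ k := by
  rcases le_total m k with h | h
  · have : (0 : ℝ) ≤ 1 / 3 ^ k := by positivity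
    linarith [cantorSum_mono c h]
  · have h1 : cantorSum c m + 1 / 3 ^ m ≤ cantorSum c k + 1 / 3 ^ k := antitone_cantorSum_add c h
    have : (0 : ℝ) ≤ 1 / 3 ^ m := by positivity
    linarith

/-- The threshold with ternary digits `2 * c j`, shifted by one. -/
noncomputable def cantorThreshold (c : ℕ → Bool) : ℝ :=
  ⨆ k, cantorSum c k

theorem cantorSum_le_cantorThreshold (c : ℕ → Bool) (k : ℕ) : cantorSum c k ≤ cantorThreshold c :=
  le_ciSup ⟨_, Set.forall_mem_range.2 (cantorSum_le_add c 0)⟩ k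

theorem cantorThreshold_le_add (c : ℕ → Bool) (k : ℕ) :
    cantorThreshold c ≤ cantorSum c k + 1 / 3 ^ k :=
  ciSup_le (cantorSum_le_add c k)

/-- The digits after position `k` add at most `1 / 3 ^ (k + 1)`, too little to imitate a digit 2 at
position `k`. -/
theorem le_cantorThreshold_iff (c : ℕ → Bool) (k : ℕ) :
    cantorSum c k + 2 / 3 ^ (k + 1) ≤ cantorThreshold c ↔ c k = true := by
  have h1 := cantorSum_le_cantorThreshold c (k + 1)
  have h2 := cantorThreshold_le_add c (k + 1)
  rw [cantorSum_succ] at h1 h2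
  constructor
  · intro h
    by_contra hc
    rw [if_neg hc] at h2
    have h3 : (0 : ℝ) < 1 / 3 ^ (k + 1) := by positivity
    have h4 : (2 : ℝ) / 3 ^ (k + 1) = 2 * (1 / 3 ^ (k + 1)) := by ring
    linarith
  · intro hc
    rwa [if_pos hc] at h1

/-- The point on the `i`-th axis whose membership in `{x | 1 ≤ ⟪w, x⟫}` determines the `k`-th
ternary digit of `w i`. -/
noncomputable def axisPoint {d : ℕ} (a : ℕ → Fin d → Bool) (i : Fin d) (k : ℕ) :
    EuclideanSpace ℝ (Fin d) :=
  EuclideanSpace.single i (cantorSum (fun j => a j i) k + 2 / 3 ^ (k + 1))⁻¹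

theorem isPredictable_axisPoint (d : ℕ) :
    IsPredictable (axisPoint : (ℕ → Fin d → Bool) → Fin d → ℕ → EuclideanSpace ℝ (Fin d)) := by
  intro a a' i k h
  have : cantorSum (fun j => a j i) k = cantorSum (fun j => a' j i) k := by
    unfold cantorSum
    congr 1
    exact Finset.sum_congr rfl fun j hj => by simp only [h j (Finset.mem_range.1 hj)]
  rw [axisPoint, axisPoint, this]

theorem map_labeledPoint_mem_realizable {d : ℕ} [NeZero d] (Q : Measure (Fin d × ℕ))
    [IsProbabilityMeasure Q] (a : ℕ → Fin d → Bool) :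
    Q.map (labeledPoint axisPoint a) ∈ Realizable (closedHalfSpaces d) := by
  classical
  have hmeas : Measurable (labeledPoint axisPoint a) := Measurable.of_discrete
  refine ⟨Measure.isProbabilityMeasure_map hmeas.aemeasurable, ?_⟩
  -- On axis `i`, `1 ≤ w i / t` is the digit test `t ≤ w i`, so one offset serves all axes. The
  -- shift by one in `cantorSum` gives `t > 0` and `w ≠ 0`.
  let w : EuclideanSpace ℝ (Fin d) := WithLp.toLp 2 fun i => cantorThreshold fun j => a j i
  let h : EuclideanSpace ℝ (Fin d) → Bool := fun x => decide (1 ≤ ⟪w, x⟫)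
  have hw : w ≠ 0 := by
    intro h0
    have h1 : w 0 = 0 := by rw [h0]; rfl
    have h2 : (1 : ℝ) ≤ w 0 :=
      (one_le_cantorSum _ 0).trans (cantorSum_le_cantorThreshold (fun j => a j 0) 0)
    linarith
  have hmem : h ∈ closedHalfSpaces d := ⟨w, hw, 1, fun x => by simp [h]⟩
  have hmeas_h : Measurable h := by
    refine measurable_to_bool ?_
    have : h ⁻¹' {true} = {x | 1 ≤ ⟪w, x⟫} := by
      ext x
      simp [h]
    rw [this]
    exact measurableSet_le measurable_const (by fun_prop)
  have hlabel : ∀ t : Fin d × ℕ, h (axisPoint a t.1 t.2) = a t.2 t.1 := by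
    rintro ⟨i, k⟩
    have hpos : 0 < cantorSum (fun j => a j i) k + 2 / 3 ^ (k + 1) := by
      have := one_le_cantorSum (fun j => a j i) k
      positivity
    rw [Bool.eq_iff_iff, ← le_cantorThreshold_iff (fun j => a j i) k]
    simp only [h, axisPoint, decide_eq_true_eq, EuclideanSpace.inner_single_right]
    simp only [w, conj_trivial]
    rw [inv_mul_eq_div, one_le_div hpos]
  refine le_antisymm ((iInf₂_le h hmem).trans (le_of_eq ?_)) bot_le
  rw [loss, Measure.map_apply hmeas]
  · convert measure_empty (μ := Q)
    ext t
    simp [labeledPoint, hlabel]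
  · exact (measurableSet_eq_fun (hmeas_h.comp measurable_fst) measurable_snd).compl

end HalfSpaces

end LearningCurves

/-! ### Choice of parameters and conclusion -/

theorem mainTheorem2 :
    ∃ α : ℝ, 0 < α ∧ ∀ d : ℕ, 1 ≤ d →
      ∀ (Ω : Type*) [MeasurableSpace Ω]
        (A : LearningCurves.LearningAlgorithm Ω (EuclideanSpace ℝ (Fin d))),
        ∃ D ∈ LearningCurves.Realizable (LearningCurves.closedHalfSpaces d),
          {n : ℕ | ENNReal.ofReal (α * (d / n)) ≤ LearningCurves.expectedLoss A D n}.Infinite := by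
  refine ⟨1 / 32, by norm_num, fun d hd Ω _ A => ?_⟩
  have : NeZero d := ⟨by omega⟩
  have hd1 : (1 : ℝ) ≤ d := by exact_mod_cast hd
  have hr0 : (0 : ℝ) < 1 / (4 * d) := by positivity
  have hr1 : (1 : ℝ) / (4 * d) ≤ 1 / 4 := one_div_le_one_div_of_le (by norm_num) (by linarith)
  obtain ⟨p, hp⟩ : ∃ p : unitInterval, (p : ℝ) = 1 - 1 / (4 * d) :=
    ⟨⟨1 - 1 / (4 * d), by linarith, by linarith⟩, rfl⟩
  have hp0 : p ≠ 0 := by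
    rintro rfl
    rw [Set.Icc.coe_zero] at hp
    linarith
  have hpr : 1 - (p : ℝ) = 1 / (4 * d) := by linarith
  -- For `k ≥ 1` the expected number of hits on `(i, k)` or deeper levels is at most `5 / 16`.
  -- Truncated subtraction makes `N 0 = N 1`, so only levels `k + 1` are used below.
  let N : ℕ → ℕ := fun k => d ^ 2 * (4 * d) ^ (k - 1)
  obtain ⟨a, ha⟩ := LearningCurves.exists_forall_le_sum_errorEvent
    (LearningCurves.isPredictable_axisPoint d) A (LearningCurves.indexMeasure d p) N
  refine ⟨_, LearningCurves.map_labeledPoint_mem_realizable (LearningCurves.indexMeasure d p) a, ?_⟩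
  have hinj : Function.Injective fun k => N (k + 1) := by
    intro k l hkl
    have h1 : (4 * d) ^ k = (4 * d) ^ l := Nat.eq_of_mul_eq_mul_left (by positivity) hkl
    exact Nat.pow_right_injective (by omega) h1
  refine Set.infinite_of_injective_forall_mem hinj fun k => ?_
  set Q := LearningCurves.indexMeasure d p
  have hN : (N (k + 1) : ℝ) = d ^ 2 * (4 * d) ^ k := by simp [N]
  have hgood : ∀ i, ENNReal.ofReal (1 / 2) ≤
      Q (LearningCurves.indicesExcept i (k + 1)) ^ N (k + 1) := by
    intro i
    have h1 := LearningCurves.le_indexMeasure_real_indicesExcept (d := d) hp0 i (k + 1)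
    set y : ℝ := (1 - p : ℝ) ^ (k + 1) * (p / d + (1 - p)) with hy
    have hpow1 : ((1 : ℝ) / (4 * d)) ^ (k + 1) ≤ 1 := pow_le_one₀ hr0.le (by linarith)
    have hp1 : (p : ℝ) / d ≤ 1 / d := by
      gcongr
      linarith
    have hy1 : y ≤ (1 / (4 * d)) ^ (k + 1) * (1 / d + 1 / (4 * d)) := by
      rw [hy, hpr]
      gcongr
    have hNy : N (k + 1) * y ≤ 1 / 2 := by
      calc N (k + 1) * y
          ≤ (d ^ 2 * (4 * d) ^ k) * ((1 / (4 * d)) ^ (k + 1) * (1 / d + 1 / (4 * d))) := by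
            rw [hN]
            gcongr
        _ = 5 / 16 := by
            rw [one_div_pow, pow_succ]
            field_simp
            ring
        _ ≤ 1 / 2 := by norm_num
    have hy2 : y ≤ 2 := by
      have : (1 : ℝ) / d ≤ 1 := by
        rw [div_le_one (by linarith)]
        exact hd1
      calc y ≤ _ := hy1
        _ ≤ 1 * (1 + 1 / 4) := by gcongr
        _ ≤ 2 := by norm_num
    -- Bernoulli turns `N * y ≤ 1 / 2` into a miss probability of at least `1 / 2`.
    have h2 := one_add_mul_le_pow (a := -y) (by linarith) (N (k + 1))
    have hy3 : 0 ≤ 1 - y := by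
      have hN1 : (1 : ℝ) ≤ N (k + 1) := by
        rw [hN]
        exact one_le_mul_of_one_le_of_one_le (one_le_pow₀ hd1) (one_le_pow₀ (by linarith))
      have hy0 : 0 ≤ y := by
        rw [hy, hpr, hp]
        have : (0 : ℝ) ≤ 1 - 1 / (4 * d) := by linarith
        positivity
      nlinarith
    rw [← ofReal_measureReal, ← ENNReal.ofReal_pow measureReal_nonneg]
    refine ENNReal.ofReal_le_ofReal ?_
    calc (1 / 2 : ℝ) ≤ 1 + N (k + 1) * -y := by linarith
      _ ≤ (1 - y) ^ N (k + 1) := by rwa [← sub_eq_add_neg] at h2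
      _ ≤ _ := pow_le_pow_left₀ hy3 h1 _
  have hsum := (Finset.sum_le_sum fun i (_ : i ∈ Finset.univ) => hgood i).trans (ha (k + 1))
  have hloss := LearningCurves.sum_errorEvent_le_expectedLoss
    (x := LearningCurves.axisPoint) A Q (N (k + 1)) (k + 1) a
  have hQ : ∀ i : Fin d, Q {(i, k + 1)} = ENNReal.ofReal ((1 - p) ^ (k + 1) * p / d) := fun i => by
    rw [← LearningCurves.indexMeasure_real_singleton hp0, ofReal_measureReal]
  simp only [hQ, ← Finset.mul_sum] at hloss
  refine le_trans ?_ hloss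
  set s := ∑ i, (A.seed.prod (Measure.pi fun _ : Fin (N (k + 1)) => Q))
    (LearningCurves.errorEvent A LearningCurves.axisPoint (N (k + 1)) (k + 1) i a)
  have hs : ENNReal.ofReal (d / 4) ≤ s := by
    rw [Finset.sum_const, Finset.card_univ, Fintype.card_fin, nsmul_eq_mul] at hsum
    rw [← ENNReal.mul_le_mul_iff_right (a := 2) (by norm_num) (by norm_num)]
    refine le_trans (le_of_eq ?_) hsum
    rw [← ENNReal.ofReal_natCast, ← ENNReal.ofReal_ofNat, ← ENNReal.ofReal_mul (by norm_num),
      ← ENNReal.ofReal_mul (by positivity)]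
    congr 1
    ring
  refine le_trans ?_ (mul_le_mul_right hs _)
  have hpnn : (0 : ℝ) ≤ (1 - p) ^ (k + 1) * p / d := by
    rw [hpr, hp]
    have : (0 : ℝ) ≤ 1 - 1 / (4 * d) := by linarith
    positivity
  rw [← ENNReal.ofReal_mul hpnn]
  refine ENNReal.ofReal_le_ofReal ?_
  have hp34 : (3 / 4 : ℝ) ≤ p := by linarith
  calc (1 / 32 : ℝ) * (d / N (k + 1)) = (1 / (4 * d)) ^ (k + 1) * (1 / 2) / d * (d / 4) := by
        rw [hN, one_div_pow, pow_succ]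
        field_simp
        ring
    _ ≤ (1 - p) ^ (k + 1) * p / d * (d / 4) := by
        rw [hpr]
        gcongr
        linarith
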